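/- All logarithms are to base 2. For a random variable $Y\in\{0,1\}^n$ with distribution $\mathbf{P}_Y$ let $\mathbf{H}_1(Y)=-\sum_x \mathbf{P}_Y(x)\log \mathbf{P}_Y(x)$ be its Shannon entropy. For a class $\mathcal{D}$ of (deterministic or randomized) distinguishers on $\{0,1\}^n$ and $\epsilon\ge 0$, a random variable $X\in\{0,1\}^n$ has at least $k$ bits of metric Shannon entropy against $(\mathcal{D},\epsilon)$ if for every $D\in\mathcal{D}$ there is a random variable $Y\in\{0,1\}^n$ with $\mathbf{H}_1(Y)\ge k$ and $|\mathbf{E}D(X)-\mathbf{E}D(Y)|\le\epsilon$, where the expectation is also over the coins of $D$ if $D$ is randomized; $\mathbf{H}_1^{\mathrm{Metric},\mathcal{D},\epsilon}(X)$ denotes the supremum of all such $k$. Let $\det\{0,1\}$ be the class of all functions $\{0,1\}^n\to\{0,1\}$, and let $\mathrm{rand}\{0,1\}$ be the class of all randomized boolean circuits on $\{0,1\}^n$, of unbounded size and with any finite number of uniform independent random coins. **Corollary.** There are absolute constants $c\in(0,1)$, $\delta>0$ and $\epsilon>0$ such that for every $n\ge 2$ there exist a random variable $X\in\{0,1\}^n$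 and a real number $k\ge cn$ with 1. $\mathbf{H}_1^{\mathrm{Metric},\det\{0,1\},0}(X)=k$, and 2. $\mathbf{H}_1^{\mathrm{Metric},\mathrm{rand}\{0,1\},\epsilon}(X)\le k-\delta n$. -/

import Mathlib

namespace MetricEntropy

/-- The cube `{0,1}^n`. -/
abbrev Cube (n : ℕ) : Type := Fin n → Bool

/-- The distributions of random variables with values in `{0,1}^n`, as probability vectors. -/
abbrev Dist (n : ℕ) : Type := stdSimplex ℝ (Cube n)

/-- Shannon entropy in bits (`0 * logb 2 0 = 0`). -/
noncomputable def shannonEntropy {n : ℕ} (X : Dist n) : ℝ :=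
  -∑ x, X.1 x * Real.logb 2 (X.1 x)

/-- The expectation `E D(X)`. -/
def expect {n : ℕ} (D : Cube n → ℝ) (X : Dist n) : ℝ :=
  ∑ x, X.1 x * D x

/-- `X` has at least `k` bits of metric Shannon entropy against `(𝒟, ε)`. -/
def HasMetricShannonEntropy {n : ℕ} (𝒟 : Set (Cube n → ℝ)) (ε : ℝ) (X : Dist n) (k : ℝ) : Prop :=
  ∀ D ∈ 𝒟, ∃ Y : Dist n, k ≤ shannonEntropy Y ∧ |expect D X - expect D Y| ≤ ε

/-- The metric Shannon entropy of `X` against `(𝒟, ε)`: the largest number of bits that it has. -/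
noncomputable def metricShannonEntropy {n : ℕ} (𝒟 : Set (Cube n → ℝ)) (ε : ℝ) (X : Dist n) : ℝ :=
  sSup {k : ℝ | HasMetricShannonEntropy 𝒟 ε X k}

/-- The class of all deterministic boolean functions on `{0,1}^n`, as `0`-`1`-valued functions. -/
def detBool (n : ℕ) : Set (Cube n → ℝ) :=
  {D | ∃ f : Cube n → Bool, D = fun x => if f x = true then 1 else 0}

/-- A gate reading some of `w` wires already computed. -/
inductive Gate (w : ℕ) : Type
  | const (b : Bool) : Gate w
  | not (i : Fin w) : Gate w
  | and (i j : Fin w) : Gate w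
  | or (i j : Fin w) : Gate w

/-- The value of a gate, given the values of the wires. -/
def Gate.eval {w : ℕ} (v : Fin w → Bool) : Gate w → Bool
  | .const b => b
  | .not i => !(v i)
  | .and i j => v i && v j
  | .or i j => v i || v j

/-- Straight-line programs with `N` inputs: `Program N w` has `w` wires, namely the inputs,
followed by one wire for each gate. -/
inductive Program (N : ℕ) : ℕ → Type
  | inputs : Program N N
  | addGate {w : ℕ} (P : Program N w) (g : Gate w) : Program N (w + 1)

/-- The values of all wires on a given input. -/
def Program.wires {N : ℕ} (a : Cube N) : {w : ℕ} → Program N w → (Fin w → Bool)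
  | _, .inputs => a
  | _, .addGate P g => Fin.snoc (α := fun _ => Bool) (P.wires a) (g.eval (P.wires a))

/-- Boolean circuits with `N` inputs, one output, and unbounded fan-out. -/
structure Circuit (N : ℕ) : Type where
  numWires : ℕ
  program : Program N numWires
  output : Fin numWires

/-- The boolean function computed by a circuit. -/
def Circuit.eval {N : ℕ} (C : Circuit N) (a : Cube N) : Bool :=
  C.program.wires a C.output

/-- The probability that a circuit with `n` inputs and `m` random inputs accepts `x`, over
uniform independent coins. -/
noncomputable def acceptProb {n m : ℕ} (C : Circuit (n + m)) (x : Cube n) : ℝ :=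
  (Finset.univ.filter fun r : Cube m => C.eval (Fin.append x r) = true).card / 2 ^ m

/-- The class of all randomized boolean circuits on `{0,1}^n`, of unbounded size and with any
number of random coins. A randomized circuit enters expectations only through its acceptance
probabilities. -/
def randCircuits (n : ℕ) : Set (Cube n → ℝ) :=
  {D | ∃ (m : ℕ) (C : Circuit (n + m)), D = acceptProb C}

/-! The supremum that defines metric entropy is over a non-empty set that is bounded above. -/

theorem metricSet_nonempty {n : ℕ} (𝒟 : Set (Cube n → ℝ)) {ε : ℝ} (hε : 0 ≤ ε) (X : Dist n) :
    {k : ℝ | HasMetricShannonEntropy 𝒟 ε X k}.Nonempty :=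
  ⟨shannonEntropy X, fun _ _ => ⟨X, le_rfl, by simpa using hε⟩⟩

theorem shannonEntropy_le {n : ℕ} (X : Dist n) :
    shannonEntropy X ≤ ∑ _x : Cube n, 1 / Real.log 2 := by
  unfold shannonEntropy
  rw [← Finset.sum_neg_distrib]
  refine Finset.sum_le_sum fun x _ => ?_
  have h0 : 0 ≤ X.1 x := X.2.1 x
  have h2 : 0 < Real.log 2 := Real.log_pos one_lt_two
  have h : -(X.1 x * Real.logb 2 (X.1 x)) = Real.negMulLog (X.1 x) / Real.log 2 := by
    simp only [Real.logb, Real.negMulLog]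
    ring
  rw [h]
  refine div_le_div_of_nonneg_right ?_ h2.le
  rcases h0.eq_or_lt with h0 | h0
  · rw [← h0]; simp
  · have h3 := mul_le_mul_of_nonneg_left (Real.one_sub_inv_le_log_of_pos h0) h0.le
    rw [mul_sub, mul_inv_cancel₀ h0.ne'] at h3
    unfold Real.negMulLog
    linarith

theorem metricSet_bddAbove {n : ℕ} {𝒟 : Set (Cube n → ℝ)} (h𝒟 : 𝒟.Nonempty) (ε : ℝ)
    (X : Dist n) : BddAbove {k : ℝ | HasMetricShannonEntropy 𝒟 ε X k} := by
  obtain ⟨D, hD⟩ := h𝒟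
  refine ⟨∑ _x : Cube n, 1 / Real.log 2, fun k hk => ?_⟩
  obtain ⟨Y, hY, -⟩ := hk D hD
  exact hY.trans (shannonEntropy_le Y)

theorem detBool_nonempty (n : ℕ) : (detBool n).Nonempty :=
  ⟨_, fun _ => true, rfl⟩

theorem randCircuits_nonempty (n : ℕ) : (randCircuits n).Nonempty :=
  ⟨_, 0, ⟨_, .addGate .inputs (.const true), Fin.last _⟩, rfl⟩

end MetricEntropy

/-!
A distribution `X` whose density is proportional to `2 ^ (t * D x)` has the largest value of
`H(Y) + t * E D(Y)` among all distributions `Y` (Gibbs' variational principle), so that the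
distinguisher `D` alone forces the metric entropy of `X` against `(𝒟, ε)` down to `H(X) + t * ε`.

Take `t = 2h` with `h = ⌊n / 2⌋`, and let `D` be `1` at one point, `1 / 2` on a set of `2 ^ h`
points, and `0` elsewhere; one coin suffices to compute `D`. Then `X` puts a constant mass on the
point and a constant mass on the set. A deterministic distinguisher is constant on each of its two
fibres, and averaging `X` over a fibre does not change its expectation. Either the fibre of the
point is exponentially large, or the other fibre contains half of the set and is exponentially
larger than the set. In both cases constant mass is spread out over exponentially more points, which
raises the entropy by a constant multiple of `n`. When `n` is small it is enough that the entropy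
increases, because `X` takes three different values and thus is not constant on both fibres.
-/

namespace MetricEntropy

open Finset Real

/-! ### Boolean functions and circuits -/

section Circuits

variable {N w : ℕ}

/-- The boolean functions that appear on the wires of a program. -/
def Program.wireFunctions (P : Program N w) : Set (Cube N → Bool) :=
  Set.range fun i a => P.wires a i

theorem Program.wireFunctions_subset_addGate (P : Program N w) (g : Gate w) :
    P.wireFunctions ⊆ (P.addGate g).wireFunctions := by
  rintro _ ⟨i, rfl⟩
  exact ⟨i.castSucc, by simp [Program.wires]⟩

theorem Program.eval_mem_wireFunctions_addGate (P : Program N w) (g : Gate w) :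
    (fun a => g.eval (P.wires a)) ∈ (P.addGate g).wireFunctions :=
  ⟨Fin.last w, by simp [Program.wires]⟩

theorem Program.input_mem_wireFunctions (P : Program N w) (i : Fin N) :
    (fun a => a i) ∈ P.wireFunctions := by
  induction P with
  | inputs => exact ⟨i, rfl⟩
  | addGate P g ih => exact P.wireFunctions_subset_addGate g ih

/-- A boolean function is programmable if every program can be continued to one that computes it.
Continuing arbitrary programs, rather than starting from the inputs, makes the notion closed under
composition. -/
def Programmable (f : Cube N → Bool) : Prop :=
  ∀ ⦃w : ℕ⦄ (P : Program N w), ∃ (w' : ℕ) (Q : Program N w'),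
    insert f P.wireFunctions ⊆ Q.wireFunctions

theorem Programmable.const (b : Bool) : Programmable fun _ : Cube N => b := fun w P =>
  ⟨w + 1, P.addGate (.const b), Set.insert_subset (P.eval_mem_wireFunctions_addGate (.const b))
    (P.wireFunctions_subset_addGate _)⟩

theorem Programmable.input (i : Fin N) : Programmable fun a : Cube N => a i := fun w P =>
  ⟨w, P, Set.insert_subset (P.input_mem_wireFunctions i) subset_rfl⟩

theorem Programmable.not {f : Cube N → Bool} (hf : Programmable f) :
    Programmable fun a => !(f a) := by
  intro w P
  obtain ⟨w', Q, hQ⟩ := hf P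
  obtain ⟨hfQ, hPQ⟩ := Set.insert_subset_iff.1 hQ
  obtain ⟨i, rfl⟩ := hfQ
  exact ⟨w' + 1, Q.addGate (.not i), Set.insert_subset (Q.eval_mem_wireFunctions_addGate (.not i))
    (hPQ.trans (Q.wireFunctions_subset_addGate _))⟩

theorem Programmable.and {f g : Cube N → Bool} (hf : Programmable f) (hg : Programmable g) :
    Programmable fun a => f a && g a := by
  intro w P
  obtain ⟨w₁, Q, hQ⟩ := hf P
  obtain ⟨w₂, R, hR⟩ := hg Q
  obtain ⟨hfQ, hPQ⟩ := Set.insert_subset_iff.1 hQ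
  obtain ⟨hgR, hQR⟩ := Set.insert_subset_iff.1 hR
  obtain ⟨i, rfl⟩ := hQR hfQ
  obtain ⟨j, rfl⟩ := hgR
  exact ⟨w₂ + 1, R.addGate (.and i j),
    Set.insert_subset (R.eval_mem_wireFunctions_addGate (.and i j))
      ((hPQ.trans hQR).trans (R.wireFunctions_subset_addGate _))⟩

theorem Programmable.decide_forall_mem {ι : Type*} (s : Finset ι) {f : ι → Cube N → Bool}
    (hf : ∀ i ∈ s, Programmable (f i)) : Programmable fun a => decide (∀ i ∈ s, f i a) := by
  classical
  induction s using Finset.induction_on with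
  | empty => simpa using Programmable.const true
  | insert i s _ ih =>
    simpa using (hf i (mem_insert_self i s)).and (ih fun j hj => hf j (mem_insert_of_mem hj))

theorem Programmable.decide_exists_mem {ι : Type*} (s : Finset ι) {f : ι → Cube N → Bool}
    (hf : ∀ i ∈ s, Programmable (f i)) : Programmable fun a => decide (∃ i ∈ s, f i a) := by
  simpa [← decide_not] using (decide_forall_mem s fun i hi => (hf i hi).not).not

theorem Programmable.beq (b : Cube N) : Programmable fun a => a == b := by
  have coordinate (i : Fin N) : Programmable fun a : Cube N => a i == b i := by
    cases h : b i
    · simpa [h] using (Programmable.input i).not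
    · simpa [h] using Programmable.input i
  convert decide_forall_mem univ fun i _ => coordinate i with a
  rw [Bool.eq_iff_iff]
  simp [funext_iff]

theorem programmable (f : Cube N → Bool) : Programmable f := by
  convert Programmable.decide_exists_mem {b | f b} fun b _ => Programmable.beq b with a
  simp

theorem exists_circuit_eval_eq (f : Cube N → Bool) : ∃ C : Circuit N, C.eval = f := by
  obtain ⟨w, Q, hQ⟩ := programmable f .inputs
  obtain ⟨o, ho⟩ := hQ (Set.mem_insert f _)
  exact ⟨⟨w, Q, o⟩, ho⟩

theorem div_two_pow_mem_randCircuits {n m : ℕ} {k : Cube n → ℕ} (hk : ∀ x, k x ≤ 2 ^ m) :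
    (fun x => (k x / 2 ^ m : ℝ)) ∈ randCircuits n := by
  have (x : Cube n) : ∃ R : Finset (Cube m), #R = k x := by
    obtain ⟨R, -, hR⟩ := exists_subset_card_eq (s := (univ : Finset (Cube m))) (n := k x)
      (by simpa using hk x)
    exact ⟨R, hR⟩
  choose R hR using this
  obtain ⟨C, hC⟩ := exists_circuit_eval_eq fun a : Cube (n + m) =>
    decide ((fun j => a (Fin.natAdd n j)) ∈ R fun i => a (Fin.castAdd m i))
  refine ⟨m, C, funext fun x => ?_⟩
  have hcoins : ({r | C.eval (Fin.append x r) = true} : Finset (Cube m)) = R x := by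
    ext r; simp [hC]
  rw [acceptProb, hcoins, hR]

end Circuits

/-! ### Entropy gained by averaging -/

theorem mul_negMulLog_div {c : ℝ} (hc : c ≠ 0) (x : ℝ) :
    c * negMulLog (x / c) = negMulLog x + x * log c := by
  have h := negMulLog_mul c (x / c)
  have h' : x / c * negMulLog c = -(x * log c) := by simp only [negMulLog]; field_simp
  rw [mul_div_cancel₀ x hc, h'] at h
  linarith

section Jensen

variable {ι : Type*} {s t : Finset ι} {p : ι → ℝ}

theorem sum_negMulLog_le (hp : ∀ i ∈ s, 0 ≤ p i) :
    ∑ i ∈ s, negMulLog (p i) ≤ #s * negMulLog ((∑ i ∈ s, p i) / #s) := by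
  rcases s.eq_empty_or_nonempty with rfl | hs
  · simp
  have hs' : (0 : ℝ) < #s := mod_cast hs.card_pos
  have h := concaveOn_negMulLog.le_map_sum (t := s) (w := fun _ => (#s : ℝ)⁻¹)
    (fun _ _ => by positivity) (by simp [hs'.ne']) hp
  simp only [smul_eq_mul, inv_mul_eq_div, ← sum_div] at h
  exact (div_le_iff₀' hs').1 h

theorem sum_negMulLog_lt (hp : ∀ i ∈ s, 0 ≤ p i) {i j : ι} (hi : i ∈ s) (hj : j ∈ s)
    (hij : p i ≠ p j) :
    ∑ i ∈ s, negMulLog (p i) < #s * negMulLog ((∑ i ∈ s, p i) / #s) := by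
  have hs' : (0 : ℝ) < #s := mod_cast card_pos.2 ⟨i, hi⟩
  have h := strictConcaveOn_negMulLog.lt_map_sum (t := s) (w := fun _ => (#s : ℝ)⁻¹)
    (fun _ _ => by positivity) (by simp [hs'.ne']) hp ⟨i, hi, j, hj, hij⟩
  simp only [smul_eq_mul, inv_mul_eq_div, ← sum_div] at h
  exact (div_lt_iff₀' hs').1 h

theorem negMulLog_add_negMulLog_le {u v : ℝ} (hu : 0 ≤ u) (hv : 0 ≤ v) :
    negMulLog u + negMulLog v ≤ negMulLog (u + v) + (u + v) * log 2 := by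
  have h := sum_negMulLog_le (s := univ) (p := ![u, v]) (by simp [Fin.forall_fin_two, hu, hv])
  simpa [mul_negMulLog_div] using h

theorem sum_negMulLog_add_mul_log_le {r c : ℝ} (hp : ∀ i ∈ s, 0 ≤ p i) (hr : 0 < r)
    (hc : r * #s ≤ c) :
    ∑ i ∈ s, negMulLog (p i) + (∑ i ∈ s, p i) * log r ≤
      negMulLog (∑ i ∈ s, p i) + (∑ i ∈ s, p i) * log c := by
  rcases s.eq_empty_or_nonempty with rfl | hs
  · simp
  have hs' : (0 : ℝ) < #s := mod_cast hs.card_pos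
  have hlog : log r + log #s ≤ log c := by
    rw [← log_mul hr.ne' hs'.ne']
    exact log_le_log (by positivity) hc
  have hjensen := sum_negMulLog_le hp
  rw [mul_negMulLog_div hs'.ne'] at hjensen
  linarith [mul_le_mul_of_nonneg_left hlog (sum_nonneg hp)]

theorem sum_negMulLog_add_le {r : ℝ} (hp : ∀ i ∈ s, 0 ≤ p i) (hp1 : ∑ i ∈ s, p i ≤ 1)
    (hts : t ⊆ s) (hr : 0 < r) (hrt : r * #t ≤ #s) :
    ∑ i ∈ s, negMulLog (p i) + ((∑ i ∈ t, p i) * log r - log 2) ≤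
      #s * negMulLog ((∑ i ∈ s, p i) / #s) := by
  classical
  have h2 : 0 < log 2 := log_pos one_lt_two
  rcases s.eq_empty_or_nonempty with rfl | hs
  · simp [subset_empty.1 hts, h2.le]
  have hpt : ∀ i ∈ t, 0 ≤ p i := fun i hi => hp i (hts hi)
  have hpd : ∀ i ∈ s \ t, 0 ≤ p i := fun i hi => hp i (sdiff_subset hi)
  have ht := sum_negMulLog_add_mul_log_le hpt hr hrt
  have hd := sum_negMulLog_add_mul_log_le (c := #s) hpd one_pos
    (by rw [one_mul]; exact mod_cast card_le_card sdiff_subset)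
  have hadd := negMulLog_add_negMulLog_le (sum_nonneg hpt) (sum_nonneg hpd)
  rw [add_comm (∑ i ∈ t, p i), sum_sdiff hts] at hadd
  rw [mul_negMulLog_div (mod_cast hs.card_pos.ne'), ← sum_sdiff hts,
    ← sum_sdiff hts (f := p), add_mul, sum_sdiff hts (f := p)]
  rw [log_one, mul_zero, add_zero] at hd
  linarith [mul_le_mul_of_nonneg_right hp1 h2.le]

end Jensen

section Average

variable {α : Type*} [Fintype α] [DecidableEq α]

theorem sum_ite_average_mul (p D : α → ℝ) {S : Finset α} (hD : ∀ x ∈ S, ∀ y ∈ S, D x = D y) :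
    ∑ x, (if x ∈ S then (∑ y ∈ S, p y) / #S else p x) * D x = ∑ x, p x * D x := by
  simp only [ite_mul, sum_ite, filter_mem_eq_inter, univ_inter, filter_notMem_eq_sdiff]
  rw [← sum_sdiff (subset_univ S) (f := fun x => p x * D x), add_comm]
  congr 1
  rcases S.eq_empty_or_nonempty with rfl | ⟨z, hz⟩
  · simp
  have hS : (#S : ℝ) ≠ 0 := mod_cast (card_pos.2 ⟨z, hz⟩).ne'
  calc ∑ x ∈ S, (∑ y ∈ S, p y) / #S * D x = ∑ _x ∈ S, (∑ y ∈ S, p y) / #S * D z :=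
        sum_congr rfl fun _ hx => by rw [hD _ hx z hz]
    _ = (∑ x ∈ S, p x) * D z := by rw [sum_const, nsmul_eq_mul]; field_simp
    _ = ∑ x ∈ S, p x * D x := by
        rw [sum_mul]; exact sum_congr rfl fun _ hx => by rw [hD _ hx z hz]

/-- The distribution obtained from `X` by spreading the mass of `S` uniformly over `S`. -/
noncomputable def averageOn (X : stdSimplex ℝ α) (S : Finset α) : stdSimplex ℝ α :=
  ⟨fun x => if x ∈ S then (∑ y ∈ S, X.1 y) / #S else X.1 x,
    fun x => by
      have := X.2.1
      dsimp only
      split_ifs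
      · exact div_nonneg (sum_nonneg fun y _ => this y) (Nat.cast_nonneg _)
      · exact this x,
    by simpa [X.2.2] using sum_ite_average_mul X.1 (fun _ => 1) (S := S) fun _ _ _ _ => rfl⟩

theorem sum_negMulLog_averageOn (X : stdSimplex ℝ α) (S : Finset α) :
    ∑ x, negMulLog ((averageOn X S).1 x) = ∑ x, negMulLog (X.1 x) +
      (#S * negMulLog ((∑ x ∈ S, X.1 x) / #S) - ∑ x ∈ S, negMulLog (X.1 x)) := by
  simp only [averageOn, apply_ite negMulLog, sum_ite, filter_mem_eq_inter, univ_inter,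
    filter_notMem_eq_sdiff, sum_const, nsmul_eq_mul]
  rw [← sum_sdiff (subset_univ S) (f := fun x => negMulLog (X.1 x))]
  ring

end Average

section ShannonEntropy

variable {n : ℕ}

theorem shannonEntropy_eq_sum_negMulLog_div (X : Dist n) :
    shannonEntropy X = (∑ x, negMulLog (X.1 x)) / log 2 := by
  rw [shannonEntropy, ← sum_neg_distrib, sum_div]
  exact sum_congr rfl fun x _ => by rw [negMulLog, logb]; ring

theorem shannonEntropy_nonneg (X : Dist n) : 0 ≤ shannonEntropy X := by
  rw [shannonEntropy_eq_sum_negMulLog_div]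
  refine div_nonneg (sum_nonneg fun x _ => negMulLog_nonneg (X.2.1 x) ?_) (log_nonneg one_le_two)
  exact (single_le_sum (fun y _ => X.2.1 y) (mem_univ x)).trans_eq X.2.2

theorem expect_averageOn (X : Dist n) {D : Cube n → ℝ} {S : Finset (Cube n)}
    (hD : ∀ x ∈ S, ∀ y ∈ S, D x = D y) : expect D (averageOn X S) = expect D X :=
  sum_ite_average_mul X.1 D hD

theorem shannonEntropy_lt_averageOn (X : Dist n) {S : Finset (Cube n)} {x y : Cube n} (hx : x ∈ S)
    (hy : y ∈ S) (hxy : X.1 x ≠ X.1 y) : shannonEntropy X < shannonEntropy (averageOn X S) := by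
  simp only [shannonEntropy_eq_sum_negMulLog_div, sum_negMulLog_averageOn]
  refine div_lt_div_of_pos_right ?_ (log_pos one_lt_two)
  linarith [sum_negMulLog_lt (fun z _ => X.2.1 z) hx hy hxy]

theorem shannonEntropy_add_le_averageOn (X : Dist n) {S U : Finset (Cube n)} (hU : U ⊆ S) {r : ℝ}
    (hr : 0 < r) (hrU : r * #U ≤ #S) :
    shannonEntropy X + ((∑ x ∈ U, X.1 x) * logb 2 r - 1) ≤ shannonEntropy (averageOn X S) := by
  have h2 : 0 < log 2 := log_pos one_lt_two
  have hS : ∑ x ∈ S, X.1 x ≤ 1 :=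
    (sum_le_univ_sum_of_nonneg X.2.1).trans_eq X.2.2
  have hgain := sum_negMulLog_add_le (fun x _ => X.2.1 x) hS hU hr hrU
  have hbits : (∑ x ∈ U, X.1 x) * logb 2 r - 1 =
      ((∑ x ∈ U, X.1 x) * log r - log 2) / log 2 := by
    rw [logb]; field_simp
  simp only [shannonEntropy_eq_sum_negMulLog_div, sum_negMulLog_averageOn, hbits, ← add_div]
  refine div_le_div_of_nonneg_right ?_ h2.le
  linarith

end ShannonEntropy

/-! ### Deterministic distinguishers -/

section Deterministic

variable {n : ℕ}

theorem le_metricShannonEntropy_detBool {X : Dist n} {k : ℝ}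
    (h : ∀ f : Cube n → Bool, ∃ b, k ≤ shannonEntropy (averageOn X {x | f x = b})) :
    k ≤ metricShannonEntropy (detBool n) 0 X := by
  refine le_csSup (metricSet_bddAbove (detBool_nonempty n) 0 X) ?_
  rintro _ ⟨f, rfl⟩
  obtain ⟨b, hb⟩ := h f
  refine ⟨averageOn X {x | f x = b}, hb, ?_⟩
  rw [expect_averageOn, sub_self, abs_zero]
  intro x hx y hy
  rw [(mem_filter.1 hx).2, (mem_filter.1 hy).2]

theorem shannonEntropy_lt_metricShannonEntropy_detBool {X : Dist n} {x y z : Cube n}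
    (hxy : X.1 x < X.1 y) (hyz : X.1 y < X.1 z) :
    shannonEntropy X < metricShannonEntropy (detBool n) 0 X := by
  have key (f : Cube n → Bool) : ∃ b, shannonEntropy X <
      shannonEntropy (averageOn X {x | f x = b}) := by
    have pigeonhole : f x = f y ∨ f y = f z ∨ f x = f z := by
      cases f x <;> cases f y <;> cases f z <;> simp
    rcases pigeonhole with h | h | h
    · exact ⟨f y, shannonEntropy_lt_averageOn X (by simpa using h) (by simp) hxy.ne⟩
    · exact ⟨f z, shannonEntropy_lt_averageOn X (by simpa using h) (by simp) hyz.ne⟩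
    · exact ⟨f z, shannonEntropy_lt_averageOn X (by simpa using h) (by simp) (hxy.trans hyz).ne⟩
  choose b hb using key
  obtain ⟨f₀, hf₀⟩ := Finite.exists_min fun f => shannonEntropy (averageOn X {x | f x = b f})
  exact (hb f₀).trans_le (le_metricShannonEntropy_detBool fun f => ⟨b f, hf₀ f⟩)

theorem card_filter_eq_add_card_filter_eq_not {α : Type*} (s : Finset α) (f : α → Bool) (b : Bool) :
    #{x ∈ s | f x = b} + #{x ∈ s | f x = !b} = #s := by
  simpa [← ne_eq, ← Bool.eq_not] using card_filter_add_card_filter_not (s := s) (fun x => f x = b)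

theorem shannonEntropy_add_le_metricShannonEntropy_detBool {m : ℕ} {μ : ℝ} {X : Dist n}
    {x₀ : Cube n} {A : Finset (Cube n)} (hn : 2 * (m + 1) ≤ n) (hcard : #A = 2 ^ (m + 1))
    (hμ : 0 ≤ μ) (hx₀ : μ ≤ X.1 x₀) (hA : ∀ x ∈ A, μ / 2 ^ (m + 1) ≤ X.1 x) :
    shannonEntropy X + (μ / 2 * m - 1) ≤ metricShannonEntropy (detBool n) 0 X := by
  have spread {S U : Finset (Cube n)} (hU : U ⊆ S) (hUS : 2 ^ m * #U ≤ #S)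
      (hμU : μ / 2 ≤ ∑ x ∈ U, X.1 x) :
      shannonEntropy X + (μ / 2 * m - 1) ≤ shannonEntropy (averageOn X S) := by
    refine le_trans ?_ (shannonEntropy_add_le_averageOn X hU (r := 2 ^ m) (by positivity)
      (mod_cast hUS))
    rw [logb_pow, logb_self_eq_one one_lt_two, mul_one]
    gcongr
  refine le_metricShannonEntropy_detBool fun f => ?_
  by_cases hlarge : 2 ^ m ≤ #{x | f x = f x₀}
  · exact ⟨f x₀, spread (U := {x₀}) (by simp) (by simpa using hlarge)
      (by rw [sum_singleton]; linarith)⟩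
  have hfibres := card_filter_eq_add_card_filter_eq_not univ f (f x₀)
  have hAfibres := card_filter_eq_add_card_filter_eq_not A f (f x₀)
  have hsub (b : Bool) : {x ∈ A | f x = b} ⊆ ({x | f x = b} : Finset (Cube n)) :=
    filter_subset_filter _ (subset_univ A)
  have hle := card_le_card (hsub (f x₀))
  rw [card_univ, Fintype.card_fun, Fintype.card_bool, Fintype.card_fin] at hfibres
  refine ⟨!f x₀, spread (hsub (!f x₀)) ?_ ?_⟩
  · have hpow : 2 * (2 ^ m * 2 ^ (m + 1)) ≤ 2 ^ n := by
      rw [← pow_add, ← pow_succ']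
      exact Nat.pow_le_pow_right two_pos (by omega)
    have hU : 2 ^ m * #{x ∈ A | f x = !f x₀} ≤ 2 ^ m * 2 ^ (m + 1) :=
      Nat.mul_le_mul_left _ (by omega)
    have hm : 2 ^ m ≤ 2 ^ m * 2 ^ (m + 1) := Nat.le_mul_of_pos_right _ (by positivity)
    omega
  · have hhalf : 2 ^ m ≤ #{x ∈ A | f x = !f x₀} := by rw [pow_succ] at hcard; omega
    calc μ / 2 = 2 ^ m * (μ / 2 ^ (m + 1)) := by rw [pow_succ]; field_simp
      _ ≤ #{x ∈ A | f x = !f x₀} * (μ / 2 ^ (m + 1)) := by gcongr; exact mod_cast hhalf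
      _ ≤ ∑ x ∈ A with f x = !f x₀, X.1 x := by
        rw [← nsmul_eq_mul]
        exact card_nsmul_le_sum _ _ _ fun x hx => hA x (mem_filter.1 hx).1

end Deterministic

/-! ### Gibbs distributions -/

section Gibbs

theorem negMulLog_add_mul_log_le {x y : ℝ} (hx : 0 ≤ x) (hy : 0 < y) :
    negMulLog x + x * log y ≤ y - x := by
  have h := mul_le_mul_of_nonneg_left (negMulLog_le_one_sub_self (div_nonneg hx hy.le)) hy.le
  rw [mul_negMulLog_div hy.ne'] at h
  linarith [mul_div_cancel₀ x hy.ne']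

theorem sum_negMulLog_le_sum_neg_mul_log {ι : Type*} {s : Finset ι} {p q : ι → ℝ}
    (hp : ∀ i ∈ s, 0 ≤ p i) (hq : ∀ i ∈ s, 0 < q i) (hqp : ∑ i ∈ s, q i ≤ ∑ i ∈ s, p i) :
    ∑ i ∈ s, negMulLog (p i) ≤ -∑ i ∈ s, p i * log (q i) := by
  have h := sum_le_sum fun i hi => negMulLog_add_mul_log_le (hp i hi) (hq i hi)
  rw [sum_add_distrib, sum_sub_distrib] at h
  linarith

section

variable {α : Type*} [Fintype α]

/-- The partition function of the Gibbs distribution for the distinguisher `D`, to base `2`. -/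
noncomputable def partitionFunction (t : ℝ) (D : α → ℝ) : ℝ :=
  ∑ x, 2 ^ (t * D x)

variable [Nonempty α]

theorem partitionFunction_pos (t : ℝ) (D : α → ℝ) : 0 < partitionFunction t D :=
  sum_pos (fun _ _ => by positivity) univ_nonempty

/-- The Gibbs distribution for the distinguisher `D`, with density proportional to
`2 ^ (t * D x)`. -/
noncomputable def gibbs (t : ℝ) (D : α → ℝ) : stdSimplex ℝ α :=
  ⟨fun x => 2 ^ (t * D x) / partitionFunction t D,
    fun x => div_nonneg (by positivity) (partitionFunction_pos t D).le, by
      rw [← sum_div]; exact div_self (partitionFunction_pos t D).ne'⟩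

theorem gibbs_apply (t : ℝ) (D : α → ℝ) (x : α) :
    (gibbs t D).1 x = 2 ^ (t * D x) / partitionFunction t D :=
  rfl

theorem gibbs_pos (t : ℝ) (D : α → ℝ) (x : α) : 0 < (gibbs t D).1 x :=
  div_pos (by positivity) (partitionFunction_pos t D)

theorem logb_gibbs (t : ℝ) (D : α → ℝ) (x : α) :
    logb 2 ((gibbs t D).1 x) = t * D x - logb 2 (partitionFunction t D) := by
  rw [gibbs_apply, logb_div (by positivity) (partitionFunction_pos t D).ne',
    logb_rpow two_pos (by norm_num)]

end

variable {n : ℕ}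

theorem sum_mul_logb_gibbs (t : ℝ) (D : Cube n → ℝ) (Y : Dist n) :
    ∑ x, Y.1 x * logb 2 ((gibbs t D).1 x) = t * expect D Y - logb 2 (partitionFunction t D) := by
  simp only [logb_gibbs, mul_sub, sum_sub_distrib, ← sum_mul, Y.2.2, one_mul, expect, mul_sum,
    mul_left_comm]

theorem shannonEntropy_gibbs (t : ℝ) (D : Cube n → ℝ) :
    shannonEntropy (gibbs t D) =
      logb 2 (partitionFunction t D) - t * expect D (gibbs t D) := by
  rw [shannonEntropy, sum_mul_logb_gibbs, neg_sub]

theorem shannonEntropy_le_logb_partitionFunction_sub (t : ℝ) (D : Cube n → ℝ) (Y : Dist n) :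
    shannonEntropy Y ≤ logb 2 (partitionFunction t D) - t * expect D Y := by
  rw [← neg_sub, ← sum_mul_logb_gibbs, shannonEntropy_eq_sum_negMulLog_div]
  simp only [logb, mul_div_assoc', ← sum_div, ← neg_div]
  gcongr
  exact sum_negMulLog_le_sum_neg_mul_log (fun x _ => Y.2.1 x) (fun x _ => gibbs_pos t D x)
    ((gibbs t D).2.2.trans Y.2.2.symm).le

theorem metricShannonEntropy_gibbs_le {t ε : ℝ} (ht : 0 ≤ t) (hε : 0 ≤ ε) {D : Cube n → ℝ}
    {𝒟 : Set (Cube n → ℝ)} (hD : D ∈ 𝒟) :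
    metricShannonEntropy 𝒟 ε (gibbs t D) ≤ shannonEntropy (gibbs t D) + t * ε := by
  refine csSup_le (metricSet_nonempty 𝒟 hε _) fun k hk => ?_
  obtain ⟨Y, hkY, hY⟩ := hk D hD
  have hexpect : t * (expect D (gibbs t D) - expect D Y) ≤ t * ε :=
    mul_le_mul_of_nonneg_left ((le_abs_self _).trans hY) ht
  linarith [shannonEntropy_gibbs t D, shannonEntropy_le_logb_partitionFunction_sub t D Y]

end Gibbs

/-! ### The three-level distinguisher -/

theorem exists_pos_forall_le_of_eventually {r : ℕ → ℝ} {c : ℝ} (hr : ∀ n, 0 < r n) (hc : 0 < c)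
    (h : ∀ᶠ n in Filter.atTop, c ≤ r n) : ∃ g > 0, ∀ n, g ≤ r n := by
  have hbdd : Filter.IsBoundedUnder (· ≤ ·) Filter.atTop fun n => (r n)⁻¹ :=
    ⟨c⁻¹, Filter.eventually_map.2 (h.mono fun n hn => inv_anti₀ hc hn)⟩
  obtain ⟨b, hb⟩ := hbdd.bddAbove_range
  have hb' (n : ℕ) : (r n)⁻¹ ≤ b := hb (Set.mem_range_self n)
  have hb0 : 0 < b := (inv_pos.2 (hr 0)).trans_le (hb' 0)
  exact ⟨b⁻¹, inv_pos.2 hb0, fun n => inv_le_of_inv_le₀ (hr n) (hb' n)⟩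

section ThreeLevel

variable {α : Type*} [DecidableEq α]

/-- The distinguisher that accepts `x₀` and accepts the other points of `A` with
probability `1 / 2`. Its Gibbs distribution separates the two classes of distinguishers. -/
noncomputable def threeLevel (x₀ : α) (A : Finset α) : α → ℝ :=
  fun x => if x = x₀ then 1 else if x ∈ A then 1 / 2 else 0

theorem threeLevel_mem_randCircuits {n : ℕ} (x₀ : Cube n) (A : Finset (Cube n)) :
    threeLevel x₀ A ∈ randCircuits n := by
  convert div_two_pow_mem_randCircuits (n := n) (m := 1)
    (k := fun x => if x = x₀ then 2 else if x ∈ A then 1 else 0)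
    (fun x => by split_ifs <;> norm_num) with x
  rw [threeLevel]
  split_ifs <;> norm_num

theorem two_rpow_mul_threeLevel (h : ℕ) (x₀ : α) (A : Finset α) (x : α) :
    (2 : ℝ) ^ (2 * h * threeLevel x₀ A x) =
      if x = x₀ then 2 ^ (2 * h) else if x ∈ A then 2 ^ h else 1 := by
  rw [threeLevel]
  split_ifs
  · rw [mul_one]; exact_mod_cast rpow_natCast 2 (2 * h)
  · rw [mul_right_comm, mul_one_div_cancel two_ne_zero, one_mul, rpow_natCast]
  · rw [mul_zero, rpow_zero]

theorem partitionFunction_threeLevel_le [Fintype α] (h : ℕ) (x₀ : α) (A : Finset α) :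
    partitionFunction (2 * h) (threeLevel x₀ A) ≤
      2 ^ (2 * h) + #A * 2 ^ h + Fintype.card α := by
  calc partitionFunction (2 * h) (threeLevel x₀ A)
      ≤ ∑ x, ((if x = x₀ then (2 : ℝ) ^ (2 * h) else 0) + (if x ∈ A then 2 ^ h else 0) + 1) := by
        refine sum_le_sum fun x _ => ?_
        have hpos : (0 : ℝ) < 2 ^ h := by positivity
        rw [two_rpow_mul_threeLevel]
        split_ifs <;> linarith
    _ = 2 ^ (2 * h) + #A * 2 ^ h + Fintype.card α := by simp [sum_add_distrib]

theorem exists_notMem_card_eq [Fintype α] {k : ℕ} (hk : k + 1 < Fintype.card α) :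
    ∃ (x₀ : α) (A : Finset α), x₀ ∉ A ∧ #A = k ∧ ∃ z, z ∉ insert x₀ A := by
  obtain ⟨B, -, hB⟩ := exists_subset_card_eq (s := (univ : Finset α)) (n := k + 1) hk.le
  obtain ⟨x₀, A, hx₀, rfl, hA⟩ := card_eq_succ.1 hB
  refine ⟨x₀, A, hx₀, hA, ?_⟩
  simpa using exists_mem_notMem_of_card_lt_card (hB.trans_lt hk)

variable {n : ℕ} {x₀ : Cube n} {A : Finset (Cube n)}

theorem shannonEntropy_gibbs_threeLevel_lt {h : ℕ} (hh : h ≠ 0) (hx₀ : x₀ ∉ A) (hA : A.Nonempty)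
    {z : Cube n} (hz : z ∉ insert x₀ A) :
    shannonEntropy (gibbs (2 * h) (threeLevel x₀ A)) <
      metricShannonEntropy (detBool n) 0 (gibbs (2 * h) (threeLevel x₀ A)) := by
  obtain ⟨y, hy⟩ := hA
  obtain ⟨hzx₀, hzA⟩ := not_or.1 (mt mem_insert.2 hz)
  have hyx₀ : y ≠ x₀ := ne_of_mem_of_not_mem hy hx₀
  have hZ := partitionFunction_pos (2 * h) (threeLevel x₀ A)
  apply shannonEntropy_lt_metricShannonEntropy_detBool (x := z) (y := y) (z := x₀) <;>
    refine div_lt_div_of_pos_right ?_ hZ <;>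
    simp only [two_rpow_mul_threeLevel, if_neg hzx₀, if_neg hzA, if_neg hyx₀, if_pos hy, if_true]
  · exact one_lt_pow₀ one_lt_two hh
  · exact pow_lt_pow_right₀ one_lt_two (by omega)

theorem shannonEntropy_gibbs_threeLevel_add_le {m : ℕ} (hmn : 2 * (m + 1) ≤ n)
    (hnm : n ≤ 2 * (m + 1) + 1) (hA : #A = 2 ^ (m + 1)) :
    shannonEntropy (gibbs (2 * (m + 1 : ℕ)) (threeLevel x₀ A)) + (m / 8 - 1) ≤
      metricShannonEntropy (detBool n) 0 (gibbs (2 * (m + 1 : ℕ)) (threeLevel x₀ A)) := by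
  set h := m + 1
  have hZ0 := partitionFunction_pos (2 * h) (threeLevel x₀ A)
  have hsq : (2 : ℝ) ^ h * 2 ^ h = 2 ^ (2 * h) := by rw [← pow_add, two_mul]
  have hZ : partitionFunction (2 * h) (threeLevel x₀ A) ≤ 4 * 2 ^ (2 * h) := by
    have hcube : (2 : ℝ) ^ n ≤ 2 * 2 ^ (2 * h) := by
      rw [← pow_succ']
      exact pow_le_pow_right₀ one_le_two hnm
    have hZsum := partitionFunction_threeLevel_le h x₀ A
    simp only [hA, Fintype.card_fun, Fintype.card_bool, Fintype.card_fin, Nat.cast_pow,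
      Nat.cast_ofNat, hsq] at hZsum
    linarith
  have hmass := shannonEntropy_add_le_metricShannonEntropy_detBool (μ := 1 / 4) (x₀ := x₀)
    (X := gibbs (2 * h) (threeLevel x₀ A)) hmn hA (by norm_num) ?_ fun x hx => ?_
  · convert hmass using 2
    ring
  · rw [gibbs_apply, two_rpow_mul_threeLevel, if_pos rfl, le_div_iff₀ hZ0]
    linarith
  · rw [gibbs_apply, two_rpow_mul_threeLevel, div_le_div_iff₀ (by positivity) hZ0, if_pos hx]
    have hle : (2 : ℝ) ^ h ≤ if x = x₀ then 2 ^ (2 * h) else 2 ^ h := by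
      split_ifs
      · exact pow_le_pow_right₀ one_le_two (by omega)
      · exact le_rfl
    calc 1 / 4 * partitionFunction (2 * h) (threeLevel x₀ A) ≤ 2 ^ h * 2 ^ h := by linarith
      _ ≤ _ := by gcongr

theorem shannonEntropy_gibbs_threeLevel_add_linear_le (hn : 38 ≤ n) (hA : #A = 2 ^ (n / 2)) :
    shannonEntropy (gibbs (2 * (n / 2 : ℕ)) (threeLevel x₀ A)) + 1 / 32 * n ≤
      metricShannonEntropy (detBool n) 0 (gibbs (2 * (n / 2 : ℕ)) (threeLevel x₀ A)) := by
  obtain ⟨m, hm⟩ : ∃ m, n / 2 = m + 1 := Nat.exists_eq_add_one.2 (by omega)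
  rw [hm] at hA ⊢
  have hgain := shannonEntropy_gibbs_threeLevel_add_le (x₀ := x₀) (n := n) (by omega) (by omega) hA
  have hnm : (n : ℝ) ≤ 2 * m + 3 := by exact_mod_cast (by omega : n ≤ 2 * m + 3)
  have hn' : (38 : ℝ) ≤ n := mod_cast hn
  linarith

theorem exists_linear_le_metricShannonEntropy_detBool_gibbs : ∃ g > 0, ∀ n ≥ 2,
    ∃ (x₀ : Cube n) (A : Finset (Cube n)),
      shannonEntropy (gibbs (2 * (n / 2 : ℕ)) (threeLevel x₀ A)) + g * n ≤
        metricShannonEntropy (detBool n) 0 (gibbs (2 * (n / 2 : ℕ)) (threeLevel x₀ A)) := by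
  have hcard (n : ℕ) : 2 ^ ((n + 2) / 2) + 1 < Fintype.card (Cube (n + 2)) := by
    have h₁ : 2 ^ ((n + 2) / 2) * 2 ≤ 2 ^ (n + 2) := by
      rw [← pow_succ]; exact Nat.pow_le_pow_right two_pos (by omega)
    have h₂ : 2 ^ 1 ≤ 2 ^ ((n + 2) / 2) := Nat.pow_le_pow_right two_pos (by omega)
    simp only [Fintype.card_fun, Fintype.card_bool, Fintype.card_fin]
    omega
  choose x₀ A hx₀ hA z hz using fun n => exists_notMem_card_eq (hcard n)
  let X (n : ℕ) : Dist (n + 2) := gibbs (2 * ((n + 2) / 2 : ℕ)) (threeLevel (x₀ n) (A n))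
  let gain (n : ℕ) : ℝ := metricShannonEntropy (detBool (n + 2)) 0 (X n) - shannonEntropy (X n)
  have gain_pos (n : ℕ) : 0 < gain n :=
    sub_pos.2 <| shannonEntropy_gibbs_threeLevel_lt (by omega) (hx₀ n)
      (card_pos.1 <| (hA n).symm ▸ Nat.two_pow_pos _) (hz n)
  have gain_linear : ∀ᶠ n : ℕ in Filter.atTop, 1 / 32 ≤ gain n / (n + 2 : ℕ) := by
    filter_upwards [Filter.eventually_ge_atTop 36] with n hn
    rw [le_div_iff₀ (by positivity), le_sub_iff_add_le']
    exact shannonEntropy_gibbs_threeLevel_add_linear_le (by omega) (hA n)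
  obtain ⟨g, hg, hgain⟩ := exists_pos_forall_le_of_eventually
    (fun n => div_pos (gain_pos n) (by positivity)) (by norm_num) gain_linear
  refine ⟨g, hg, fun n hn => ?_⟩
  obtain ⟨n, rfl⟩ := Nat.exists_eq_add_of_le' hn
  refine ⟨x₀ n, A n, ?_⟩
  have hg_le := hgain n
  rwa [le_div_iff₀ (by positivity), le_sub_iff_add_le'] at hg_le

end ThreeLevel

end MetricEntropy

theorem mainTheorem5 :
    ∃ c δ ε : ℝ, 0 < c ∧ c < 1 ∧ 0 < δ ∧ 0 < ε ∧
      ∀ n : ℕ, 2 ≤ n → ∃ (X : MetricEntropy.Dist n) (k : ℝ),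
        c * n ≤ k ∧
        MetricEntropy.metricShannonEntropy (MetricEntropy.detBool n) 0 X = k ∧
        MetricEntropy.metricShannonEntropy (MetricEntropy.randCircuits n) ε X ≤ k - δ * n := by
  obtain ⟨g, hg, hdet⟩ := MetricEntropy.exists_linear_le_metricShannonEntropy_detBool_gibbs
  refine ⟨min g (1 / 2), g / 2, g / 2, lt_min hg (by norm_num),
    (min_le_right _ _).trans_lt (by norm_num), half_pos hg, half_pos hg, fun n hn => ?_⟩
  obtain ⟨x₀, A, hX⟩ := hdet n hn
  refine ⟨MetricEntropy.gibbs (2 * (n / 2 : ℕ)) (MetricEntropy.threeLevel x₀ A), _, ?_, rfl, ?_⟩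
  · calc min g (1 / 2) * n ≤ g * n := by gcongr; exact min_le_left _ _
      _ ≤ _ := (le_add_of_nonneg_left (MetricEntropy.shannonEntropy_nonneg _)).trans hX
  · have hrand := MetricEntropy.metricShannonEntropy_gibbs_le (t := 2 * (n / 2 : ℕ)) (by positivity)
      (half_pos hg).le (MetricEntropy.threeLevel_mem_randCircuits x₀ A)
    have ht : (2 * (n / 2 : ℕ) : ℝ) ≤ n := by exact_mod_cast Nat.mul_div_le n 2
    linarith [mul_le_mul_of_nonneg_right ht (half_pos hg).le]
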